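/- Let $n\ge 1$ and $p\in[0,1]$. Suppose $n$ cars enter, one after another, a street with spots numbered $1,\dots,n$. Car $i$ has a preferred spot $a_i$, and the preference vector $\alpha=(a_1,\dots,a_n)\in[n]^n$, where $[n]=\{1,\dots,n\}$, is chosen uniformly at random. Each car goes to its preferred spot and parks there if it is free. Otherwise it tosses a coin, independently of everything else: with probability $p$ it moves forward and parks in the first free spot after $a_i$, and with probability $1-p$ it moves backward and parks in the first free spot before $a_i$ that it meets; if there is no free spot in the chosen direction, the car leaves the street without parking. Write $\alpha\in PF_n$ for the event that all $n$ cars park. This event has positive probability, and for every $j\in[n]$, \[ \mathrm{P}(a_n=j\mid\alpha\in PF_n)=\frac{2}{n+1}-\frac{1}{(n+1)^{n-1}}\Big[p\sum_{s=n-j+1}^{n-1}\binom{n-1}{s}(n-s)^{n-s-2}(s+1)^{s-1}+(1-p)\sum_{s=0}^{n-j-1}\binom{n-1}{s}(n-s)^{n-s-2}(s+1)^{s-1}\Big], \] where empty sums are $0$. In particular, if $Q_{n,p}(j)$ denotes this conditional probability, then $Q_{n,p}(j)=p\,Q_{n,1}(j)+(1-p)\,Q_{n,0}(j)$ for all $j\in[n]$;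 and if $n\ge 2$ the law depends on $p$: for $p\ne q$ in $[0,1]$ there is $j\in[n]$ with $Q_{n,p}(j)\neq Q_{n,q}(j)$. -/

import Mathlib

open scoped unitInterval

namespace CoinParking

/-- The spot taken by a single car on a street whose spots are `Fin n` (spot number `k` is the
element with value `k - 1`). `occ` is the set of occupied spots, `a` the preferred spot, and
`heads` the result of the coin toss of this car, which matters only if `a` is occupied. The car
parks at `a` if `a` is free. Otherwise it takes the first free spot after `a` if the toss is heads
and the first free spot before `a`, moving backwards, if it is tails. The value `none` means that
the car leaves the street without parking. -/
def chooseSpot {n : ℕ} (occ : Finset (Fin n)) (a : Fin n) (heads : Bool) : Option (Fin n) :=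
  if a ∉ occ then some a
  else if heads = true then
    if h : (Finset.univ.filter fun b => a < b ∧ b ∉ occ).Nonempty then
      some ((Finset.univ.filter fun b => a < b ∧ b ∉ occ).min' h)
    else none
  else
    if h : (Finset.univ.filter fun b => b < a ∧ b ∉ occ).Nonempty then
      some ((Finset.univ.filter fun b => b < a ∧ b ∉ occ).max' h)
    else none

/-- The set of occupied spots after the first `i` cars have entered, for the preference vector `a`
and the coin tosses `c` of `m` cars on a street with `n` spots. -/
def occupied {m n : ℕ} (a : Fin m → Fin n) (c : Fin m → Bool) : ℕ → Finset (Fin n)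
  | 0 => ∅
  | i + 1 =>
    if h : i < m then
      match chooseSpot (occupied a c i) (a ⟨i, h⟩) (c ⟨i, h⟩) with
      | some s => insert s (occupied a c i)
      | none => occupied a c i
    else occupied a c i

/-- All cars park. -/
def AllPark {m n : ℕ} (a : Fin m → Fin n) (c : Fin m → Bool) : Prop :=
  ∀ i : Fin m, (chooseSpot (occupied a c i) (a i) (c i)).isSome = true

/-- The probability space of the parking process with `n` cars and `n` spots: the preference
vector is uniform, and independently of it the coins of the cars are independent, each of them
landing heads (`true`) with probability `p` and tails (`false`) with probability `1 - p`. -/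
noncomputable def parkingMeasure (n : ℕ) (p : I) :
    MeasureTheory.Measure ((Fin n → Fin n) × (Fin n → Bool)) :=
  (ProbabilityTheory.uniformOn (Set.univ : Set (Fin n → Fin n))).prod
    (MeasureTheory.Measure.pi fun _ : Fin n => ProbabilityTheory.bernoulliMeasure true false p)

/-- The event that all `n` cars park. -/
def parkEvent (n : ℕ) : Set ((Fin n → Fin n) × (Fin n → Bool)) :=
  {ω | AllPark ω.1 ω.2}

/-- The event that the last car prefers spot number `j`. -/
def lastPrefEvent (n : ℕ) (hn : 1 ≤ n) (j : ℕ) : Set ((Fin n → Fin n) × (Fin n → Bool)) :=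
  {ω | (ω.1 ⟨n - 1, Nat.sub_one_lt_of_lt hn⟩ : ℕ) + 1 = j}

/-- The conditional probability that the last car prefers spot number `j`, given that all cars
park, under forward probability `p`. -/
noncomputable def lastPrefLaw (n : ℕ) (hn : 1 ≤ n) (p : I) (j : ℕ) : ℝ :=
  (ProbabilityTheory.cond (parkingMeasure n p) (parkEvent n)).real (lastPrefEvent n hn j)

end CoinParking

/-! Fix the coin tosses and count preference vectors. When the last car parks at `b`, the earlier
cars have filled the spots on either side of `b` without ever using `b`, so the two sides evolve
independently. The cars can be divided between the sides in a binomial number of ways, which gives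
the product `gapNumber`. If `s` spots lie before `b` and `m` other cars have parked, the last car
has `s + 1` admissible preferences when moving forward and `m - s + 1` when moving backward. By
Abel's identity and the symmetry `s ↔ m - s`, both weighted sums equal `(m + 2) ^ m`. Hence the
count for an interval of spots does not depend on the coins (`outcomeCount_of_ordConnected`).

For the law of the last preference, put `m = n - 1`. The first `m` cars leave a single spot `k`
free, in `gapNumber m k` ways. The last car then parks exactly when `j ≤ k` (forward) or `k ≤ j`
(backward). The conditional law is therefore a mixture of two partial sums of `gapNumber` divided by
`(n + 1) ^ (n - 1)`. Taking complements in the total sum, which equals `2 * (n + 1) ^ (n - 2)`,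
yields the stated form. At `j = 1` the two partial sums differ once `n ≥ 2`, so the law depends on
`p`. -/

namespace CoinParking

/-! ### Abel's binomial identity -/

section Abel

open Polynomial

/-- Vanishing of a top-order finite difference of a power. -/
lemma sum_alternating_choose_mul_pow (N : ℕ) :
    ∑ k ∈ Finset.range (N + 2),
      (-1 : ℚ) ^ (N + 1 - k) * ((N + 1).choose k : ℚ) * ((k : ℚ) + 1) ^ N = 0 := by
  have h := congrFun (fwdDiff_iter_pow_eq_zero_of_lt (R := ℚ) (Nat.lt_succ_self N)) 1
  rw [fwdDiff_iter_eq_sum_shift] at h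
  simpa [add_comm, show N + 2 = 1 + (N + 1) by ring] using h

/-- A case of Abel's binomial identity, as an identity of polynomials. -/
lemma abel_polynomial (N : ℕ) :
    ∑ k ∈ Finset.range (N + 1), C ((N.choose k : ℚ) * ((k : ℚ) + 1) ^ (k - 1)) *
      (X + C ((N - k : ℕ) : ℚ)) ^ (N - k) = (X + C ((N : ℚ) + 1)) ^ N := by
  induction N with
  | zero => simp
  | succ N ih =>
    rw [← sub_eq_zero]
    set q : ℚ[X] := _ - _ with hq
    -- Differentiating the identity for `N + 1` gives `N + 1` times the identity for `N` with `X`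
    -- replaced by `X + 1`.
    have hd : derivative q = 0 := by
      have hc := congrArg (fun r : ℚ[X] => C ((N : ℚ) + 1) * r.comp (X + 1)) ih
      simp only [sum_comp, mul_comp, pow_comp, add_comp, X_comp, C_comp] at hc
      rw [hq, derivative_sub, derivative_sum, sub_eq_zero, Finset.sum_range_succ]
      simp only [derivative_mul, derivative_C, derivative_X_add_C_pow, zero_mul, zero_add,
        Nat.sub_self, Nat.cast_zero, pow_zero, derivative_one, mul_zero, add_zero, C_0]
      rw [Finset.mul_sum] at hc
      convert hc using 1
      · refine Finset.sum_congr rfl fun k hk => ?_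
        have hk' : k ≤ N := Nat.lt_succ_iff.mp (Finset.mem_range.mp hk)
        obtain ⟨d, rfl⟩ := Nat.exists_eq_add_of_le hk'
        have e1 : k + d + 1 - k = d + 1 := by omega
        have e2 : k + d - k = d := by omega
        have h3 : ((k + d + 1).choose k : ℚ) * ((d : ℚ) + 1)
            = ((k + d : ℕ) + 1) * ((k + d).choose k : ℚ) := by
          have := Nat.choose_mul_succ_eq (k + d) k
          rw [e1] at this
          rw [mul_comm ((((k + d : ℕ) : ℚ)) + 1)]
          exact_mod_cast this.symm
        rw [e1, e2]
        have h4 : (X + C ((d + 1 : ℕ) : ℚ) : ℚ[X]) = X + 1 + C (d : ℚ) := by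
          simp; ring
        rw [h4]
        have h5 : C (((k + d + 1).choose k : ℚ)) * C ((d : ℚ) + 1)
            = C (((k + d : ℕ) : ℚ) + 1) * C ((k + d).choose k : ℚ) := by
          rw [← C_mul, ← C_mul, h3]
        simp only [C_mul, Nat.add_sub_cancel, Nat.cast_add, Nat.cast_one] at h5 ⊢
        linear_combination (C (((k : ℚ) + 1) ^ (k - 1)) * (X + 1 + C (d : ℚ)) ^ d) * h5
      · simp only [Nat.add_sub_cancel, Nat.cast_add, Nat.cast_one]
        congr 2
        simp; ring
    rw [eq_C_of_derivative_eq_zero hd]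
    -- This point fixes the constant: the right side vanishes, and each base on the left becomes
    -- `-(k + 1)`, so the powers of `k + 1` merge into an alternating sum of `N`-th powers.
    have he : q.eval (-((N : ℚ) + 2)) = 0 := by
      rw [hq, eval_sub, eval_finsetSum, sub_eq_zero]
      have hr : (((X : ℚ[X]) + C (((N + 1 : ℕ) : ℚ) + 1)) ^ (N + 1)).eval (-((N : ℚ) + 2)) = 0 := by
        simp; ring
      rw [hr, ← sum_alternating_choose_mul_pow N]
      refine Finset.sum_congr rfl fun k hk => ?_
      obtain ⟨d, hd'⟩ := Nat.exists_eq_add_of_le (Nat.lt_succ_iff.mp (Finset.mem_range.mp hk))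
      have e1 : N + 1 - k = d := by omega
      have hN : (N : ℚ) = k + d - 1 := by
        have : (N : ℚ) + 1 = k + d := by exact_mod_cast hd'
        linarith
      rw [e1]
      simp only [eval_mul, eval_C, eval_pow, eval_add, eval_X]
      have e3 : -((N : ℚ) + 2) + d = (-1) * ((k : ℚ) + 1) := by rw [hN]; ring
      rw [e3, mul_pow]
      -- At `k = 0` the truncated exponent `k - 1` is harmless because the base is `1`.
      rcases Nat.eq_zero_or_pos k with rfl | hk0
      · simp
      · have e4 : N = (k - 1) + d := by omega
        have e5 : ((k : ℚ) + 1) ^ N = ((k : ℚ) + 1) ^ (k - 1) * ((k : ℚ) + 1) ^ d := by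
          rw [← pow_add, ← e4]
        rw [e5]; ring
    rw [eq_C_of_derivative_eq_zero hd, eval_C] at he
    rw [he, C_0]

end Abel

/-! ### Weighted sums of gap numbers -/

/-- The number of parking functions of `m` cars on `m` spots. -/
def parkingNumber (m : ℕ) : ℕ := (m + 1) ^ (m - 1)

/-- The number of ways for `m` cars to park on `m + 1` spots leaving free the spot with exactly `s`
spots before it. -/
def gapNumber (m s : ℕ) : ℕ := m.choose s * (parkingNumber s * parkingNumber (m - s))

lemma gapNumber_symm {m s : ℕ} (h : s ≤ m) : gapNumber m (m - s) = gapNumber m s := by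
  unfold gapNumber
  rw [Nat.choose_symm h, Nat.sub_sub_self h, mul_comm (parkingNumber s)]

/-- Abel's identity at `X = 1`: the weight raises `(m - s + 1) ^ (m - s - 1)` to the exponent `m -
s`. -/
lemma sum_gapNumber_mul_succ' (m : ℕ) :
    ∑ s ∈ Finset.range (m + 1), gapNumber m s * (m - s + 1) = parkingNumber (m + 1) := by
  have h := congrArg (Polynomial.eval 1) (abel_polynomial m)
  simp only [Polynomial.eval_finsetSum, Polynomial.eval_mul, Polynomial.eval_C,
    Polynomial.eval_pow, Polynomial.eval_add, Polynomial.eval_X] at h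
  have h2 : ((∑ s ∈ Finset.range (m + 1), gapNumber m s * (m - s + 1) : ℕ) : ℚ)
      = (parkingNumber (m + 1) : ℕ) := by
    rw [parkingNumber, Nat.add_sub_cancel]
    push_cast
    have e : ((m : ℚ) + 1 + 1) = 1 + (m + 1) := by ring
    rw [e, ← h]
    refine Finset.sum_congr rfl fun k hk => ?_
    rw [gapNumber, parkingNumber, parkingNumber]
    generalize m - k = d
    have e2 : ((d : ℚ) + 1) ^ d = ((d : ℚ) + 1) ^ (d - 1) * (d + 1) := by
      cases d with
      | zero => simp
      | succ d => rw [Nat.add_sub_cancel, pow_succ]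
    push_cast
    rw [add_comm 1 (d : ℚ), e2]; ring
  exact_mod_cast h2

lemma sum_gapNumber_mul_succ (m : ℕ) :
    ∑ s ∈ Finset.range (m + 1), gapNumber m s * (s + 1) = parkingNumber (m + 1) := by
  rw [← sum_gapNumber_mul_succ', ← Finset.sum_range_reflect]
  refine Finset.sum_congr rfl fun s hs => ?_
  have := Finset.mem_range.mp hs
  rw [show m + 1 - 1 - s = m - s by omega, gapNumber_symm (by omega)]

/-- The mirror-image weights `s + 1` and `m - s + 1` add up to the constant `m + 2`. -/
lemma sum_gapNumber (m : ℕ) :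
    ∑ s ∈ Finset.range (m + 1), gapNumber m s * (m + 2) = 2 * parkingNumber (m + 1) := by
  rw [two_mul]
  nth_rw 1 [← sum_gapNumber_mul_succ]
  rw [← sum_gapNumber_mul_succ', ← Finset.sum_add_distrib]
  refine Finset.sum_congr rfl fun s hs => ?_
  have := Finset.mem_range.mp hs
  rw [← mul_add]
  congr 1
  omega

/-! ### Counting preference lists by the set of spots taken -/

section Outcome

variable {α : Type*} [LinearOrder α]

open Classical in
/-- The number of preferences which bring a car to the spot `b` when the spots in `A` are
occupied and `b` is free. -/
noncomputable def preferenceCount (A : Finset α) (heads : Bool) (b : α) : ℕ :=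
  ((insert b A).filter fun x => if heads = true then x ≤ b ∧ ∀ y, x ≤ y → y < b → y ∈ A
    else b ≤ x ∧ ∀ y, b < y → y ≤ x → y ∈ A).card

/-- The number of preference lists for which all cars park and occupy together the set `B`; the
coin tosses of the cars are listed with the last car first. -/
noncomputable def outcomeCount : List Bool → Finset α → ℕ
  | [], B => if B = ∅ then 1 else 0
  | c :: cs, B => ∑ b ∈ B, outcomeCount cs (B.erase b) * preferenceCount (B.erase b) c b

lemma outcomeCount_eq_zero (cs : List Bool) (B : Finset α) (h : cs.length ≠ B.card) :
    outcomeCount cs B = 0 := by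
  induction cs generalizing B with
  | nil =>
    rw [outcomeCount, if_neg]
    rintro rfl
    simp at h
  | cons c cs ih =>
    rw [outcomeCount]
    refine Finset.sum_eq_zero fun b hb => ?_
    rw [ih, zero_mul]
    have := Finset.card_erase_add_one hb
    simp only [List.length_cons] at h
    omega

/-- The sum of `f l₁ * g l₂` over all ways to split a list into two complementary sublists. -/
def shuffleSum : (List Bool → ℕ) → (List Bool → ℕ) → List Bool → ℕ
  | f, g, [] => f [] * g []
  | f, g, c :: cs => shuffleSum (fun l => f (c :: l)) g cs + shuffleSum f (fun l => g (c :: l)) cs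

lemma shuffleSum_sum_left {ι : Type*} (s : Finset ι) (f : ι → List Bool → ℕ) (w : ι → ℕ)
    (g : List Bool → ℕ) (cs : List Bool) :
    shuffleSum (fun l => ∑ i ∈ s, f i l * w i) g cs = ∑ i ∈ s, shuffleSum (f i) g cs * w i := by
  induction cs generalizing f g with
  | nil => simp only [shuffleSum, Finset.sum_mul]; exact Finset.sum_congr rfl fun _ _ => by ring
  | cons c cs ih =>
    simp only [shuffleSum]
    rw [ih (fun i l => f i (c :: l)), ih, ← Finset.sum_add_distrib]
    exact Finset.sum_congr rfl fun _ _ => by ring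

lemma shuffleSum_comm (f g : List Bool → ℕ) (cs : List Bool) :
    shuffleSum f g cs = shuffleSum g f cs := by
  induction cs generalizing f g with
  | nil => simp only [shuffleSum, mul_comm]
  | cons c cs ih =>
    simp only [shuffleSum]
    rw [ih, ih f, add_comm]

/-- Only splittings with `i` entries on the left contribute; the recursion of `shuffleSum` is then
Pascal's rule. -/
lemma shuffleSum_ite (i j P Q : ℕ) (cs : List Bool) (h : cs.length = i + j) :
    shuffleSum (fun l => if l.length = i then P else 0) (fun l => if l.length = j then Q else 0) cs
      = (i + j).choose i * (P * Q) := by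
  have hz : ∀ (cs : List Bool) (g : List Bool → ℕ), shuffleSum (fun _ => 0) g cs = 0 := by
    intro cs
    induction cs with
    | nil => simp [shuffleSum]
    | cons c cs ih => intro g; simp [shuffleSum, ih]
  induction cs generalizing i j with
  | nil =>
    obtain ⟨rfl, rfl⟩ : i = 0 ∧ j = 0 := by simp at h; omega
    simp [shuffleSum]
  | cons c cs ih =>
    simp only [shuffleSum, List.length_cons] at h ⊢
    rcases i with _ | i
    · rcases j with _ | j
      · omega
      · simp only [Nat.add_right_cancel_iff, Nat.succ_ne_zero, if_false, hz]
        rw [ih 0 j (by omega)]; simp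
    · rcases j with _ | j
      · simp only [Nat.add_right_cancel_iff, Nat.succ_ne_zero, if_false]
        rw [shuffleSum_comm (fun l => if l.length = i + 1 then P else 0), hz, ih i 0 (by omega)]
        simp
      · simp only [Nat.add_right_cancel_iff]
        rw [ih i (j + 1) (by omega), ih (i + 1) j (by omega),
          show i + 1 + (j + 1) = (i + (j + 1)) + 1 by ring, Nat.choose_succ_succ,
          show i + 1 + j = i + (j + 1) by ring]
        ring

/-- The spot `k` is free, so a car coming from beyond `k` would stop there and never reach `b`. -/
lemma preferenceCount_union_left {S T : Finset α} {k b : α} (hS : ∀ x ∈ S, x < k)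
    (hT : ∀ x ∈ T, k < x) (hb : b < k) (c : Bool) :
    preferenceCount (S ∪ T) c b = preferenceCount S c b := by
  unfold preferenceCount
  congr 1
  ext x
  simp only [Finset.mem_filter, Finset.mem_insert, Finset.mem_union]
  cases c
  · simp only [Bool.false_eq_true, if_false]
    constructor
    · rintro ⟨hx, hbx, h⟩
      have hxk : x < k := by
        by_contra hc
        rcases h k hb (not_lt.mp hc) with h | h
        · exact lt_irrefl _ (hS k h)
        · exact lt_irrefl _ (hT k h)
      refine ⟨?_, hbx, fun y hy hy' => (h y hy hy').resolve_right fun h' =>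
        lt_asymm (hT y h') (hy'.trans_lt hxk)⟩
      rcases hx with h | h | h
      · exact Or.inl h
      · exact Or.inr h
      · exact absurd (hT x h) hxk.not_gt
    · rintro ⟨hx, hbx, h⟩
      exact ⟨hx.imp_right Or.inl, hbx, fun y hy hy' => Or.inl (h y hy hy')⟩
  · simp only [if_true]
    constructor
    · rintro ⟨hx, hbx, h⟩
      refine ⟨?_, hbx, fun y hy hy' => (h y hy hy').resolve_right fun h' =>
        lt_asymm (hT y h') (hy'.trans hb)⟩
      rcases hx with h | h | h
      · exact Or.inl h
      · exact Or.inr h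
      · exact absurd (hT x h) (hbx.trans_lt hb).not_gt
    · rintro ⟨hx, hbx, h⟩
      exact ⟨hx.imp_right Or.inl, hbx, fun y hy hy' => Or.inl (h y hy hy')⟩

lemma preferenceCount_union_right {S T : Finset α} {k b : α} (hS : ∀ x ∈ S, x < k)
    (hT : ∀ x ∈ T, k < x) (hb : k < b) (c : Bool) :
    preferenceCount (S ∪ T) c b = preferenceCount T c b := by
  unfold preferenceCount
  congr 1
  ext x
  simp only [Finset.mem_filter, Finset.mem_insert, Finset.mem_union]
  cases c
  · simp only [Bool.false_eq_true, if_false]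
    constructor
    · rintro ⟨hx, hbx, h⟩
      refine ⟨?_, hbx, fun y hy hy' => (h y hy hy').resolve_left fun h' =>
        lt_asymm (hS y h') (hb.trans hy)⟩
      rcases hx with h | h | h
      · exact Or.inl h
      · exact absurd (hS x h) (hb.trans_le hbx).not_gt
      · exact Or.inr h
    · rintro ⟨hx, hbx, h⟩
      exact ⟨hx.imp_right Or.inr, hbx, fun y hy hy' => Or.inr (h y hy hy')⟩
  · simp only [if_true]
    constructor
    · rintro ⟨hx, hbx, h⟩
      have hxk : k < x := by
        by_contra hc
        rcases h k (not_lt.mp hc) hb with h | h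
        · exact lt_irrefl _ (hS k h)
        · exact lt_irrefl _ (hT k h)
      refine ⟨?_, hbx, fun y hy hy' => (h y hy hy').resolve_left fun h' =>
        lt_asymm (hS y h') (hxk.trans_le hy)⟩
      rcases hx with h | h | h
      · exact Or.inl h
      · exact absurd (hS x h) hxk.not_gt
      · exact Or.inr h
    · rintro ⟨hx, hbx, h⟩
      exact ⟨hx.imp_right Or.inr, hbx, fun y hy hy' => Or.inr (h y hy hy')⟩

/-- Cars parking on the two sides of a spot which stays free do not interact. -/
lemma outcomeCount_union {S T : Finset α} {k : α} (hS : ∀ x ∈ S, x < k) (hT : ∀ x ∈ T, k < x)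
    (cs : List Bool) :
    outcomeCount cs (S ∪ T)
      = shuffleSum (fun l => outcomeCount l S) (fun l => outcomeCount l T) cs := by
  induction cs generalizing S T with
  | nil =>
    simp only [outcomeCount, shuffleSum, Finset.union_eq_empty]
    split_ifs <;> simp_all
  | cons c cs ih =>
    have hd : Disjoint S T := Finset.disjoint_left.mpr fun x h h' => lt_asymm (hS x h) (hT x h')
    simp only [shuffleSum]
    simp only [outcomeCount]
    -- The last car parks in `S` or in `T`; these cases are the two terms of the recursion of
    -- `shuffleSum`.
    rw [Finset.sum_union hd, shuffleSum_sum_left,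
      shuffleSum_comm (fun l => outcomeCount l S), shuffleSum_sum_left]
    congr 1
    · refine Finset.sum_congr rfl fun b hb => ?_
      have hS' : ∀ x ∈ S.erase b, x < k := fun x hx => hS x (Finset.mem_of_mem_erase hx)
      rw [Finset.erase_union_distrib,
        Finset.erase_eq_of_notMem (Finset.disjoint_left.mp hd hb), ih hS' hT,
        preferenceCount_union_left hS' hT (hS b hb)]
    · refine Finset.sum_congr rfl fun b hb => ?_
      have hT' : ∀ x ∈ T.erase b, k < x := fun x hx => hT x (Finset.mem_of_mem_erase hx)
      rw [Finset.erase_union_distrib,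
        Finset.erase_eq_of_notMem (Finset.disjoint_right.mp hd hb), ih hS hT',
        preferenceCount_union_right hS hT' (hT b hb), shuffleSum_comm]

/-- Summing over a finite chain a function of the rank. -/
lemma sum_card_filter_lt (B : Finset α) (h : ℕ → ℕ) :
    ∑ b ∈ B, h (B.filter (· < b)).card = ∑ i ∈ Finset.range B.card, h i := by
  induction B using Finset.induction_on_max with
  | empty => simp
  | insert M s hM ih =>
    have hn : M ∉ s := fun h => lt_irrefl _ (hM M h)
    rw [Finset.sum_insert hn, Finset.card_insert_of_notMem hn, Finset.sum_range_succ, ← ih,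
      add_comm]
    congr 1
    · refine Finset.sum_congr rfl fun b hb => ?_
      rw [Finset.filter_insert, if_neg (hM b hb).not_gt]
    · rw [Finset.filter_insert, if_neg (lt_irrefl M), Finset.filter_true_of_mem hM]

lemma filter_lt_union_filter_gt (B : Finset α) (b : α) :
    B.filter (· < b) ∪ B.filter (b < ·) = B.erase b := by
  ext x
  simp only [Finset.mem_union, Finset.mem_filter, Finset.mem_erase]
  rcases lt_trichotomy x b with h | h | h
  · simp [h, h.ne, h.not_gt]
  · simp [h]
  · simp [h, h.ne', h.not_gt]

lemma card_filter_lt_add_card_filter_gt {B : Finset α} {b : α} (hb : b ∈ B) :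
    (B.filter (· < b)).card + (B.filter (b < ·)).card + 1 = B.card := by
  rw [← Finset.card_union_of_disjoint, filter_lt_union_filter_gt, Finset.card_erase_add_one hb]
  refine Finset.disjoint_left.mpr fun x h h' => ?_
  exact lt_asymm (Finset.mem_filter.mp h).2 (Finset.mem_filter.mp h').2

/-- In an interval everything between a preference and `b` is occupied, so only the side of `b`
matters. -/
lemma preferenceCount_erase {B : Finset α} (hB : (B : Set α).OrdConnected) {b : α} (hb : b ∈ B)
    (c : Bool) :
    preferenceCount (B.erase b) c b = if c = true then (B.filter (· < b)).card + 1
      else (B.filter (b < ·)).card + 1 := by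
  have hB' : ∀ {x y z}, x ∈ B → z ∈ B → x ≤ y → y ≤ z → y ∈ B := fun hx hz h1 h2 =>
    Finset.mem_coe.mp (hB.out (Finset.mem_coe.mpr hx) (Finset.mem_coe.mpr hz) ⟨h1, h2⟩)
  unfold preferenceCount
  rw [Finset.insert_erase hb]
  cases c
  · simp only [Bool.false_eq_true, if_false]
    rw [← Finset.card_insert_of_notMem (a := b) (by simp)]
    congr 1
    ext x
    simp only [Finset.mem_filter, Finset.mem_insert, Finset.mem_erase]
    constructor
    · rintro ⟨hx, hbx, -⟩
      rcases hbx.eq_or_lt with h | h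
      · exact Or.inl h.symm
      · exact Or.inr ⟨hx, h⟩
    · rintro (rfl | ⟨hx, h⟩)
      · exact ⟨hb, le_rfl, fun y h1 h2 => absurd (h1.trans_le h2) (lt_irrefl _)⟩
      · exact ⟨hx, h.le, fun y h1 h2 => ⟨h1.ne', hB' hb hx h1.le h2⟩⟩
  · simp only [if_true]
    rw [← Finset.card_insert_of_notMem (a := b) (by simp)]
    congr 1
    ext x
    simp only [Finset.mem_filter, Finset.mem_insert, Finset.mem_erase]
    constructor
    · rintro ⟨hx, hbx, -⟩
      rcases hbx.eq_or_lt with h | h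
      · exact Or.inl h
      · exact Or.inr ⟨hx, h⟩
    · rintro (rfl | ⟨hx, h⟩)
      · exact ⟨hb, le_rfl, fun y h1 h2 => absurd (h1.trans_lt h2) (lt_irrefl _)⟩
      · exact ⟨hx, h.le, fun y h1 h2 => ⟨h2.ne, hB' hx hb h1 h2.le⟩⟩

lemma ordConnected_filter_lt {B : Finset α} (hB : (B : Set α).OrdConnected) (b : α) :
    ((B.filter (· < b) : Finset α) : Set α).OrdConnected := by
  rw [Finset.coe_filter]
  exact hB.inter Set.ordConnected_Iio

lemma ordConnected_filter_gt {B : Finset α} (hB : (B : Set α).OrdConnected) (b : α) :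
    ((B.filter (b < ·) : Finset α) : Set α).OrdConnected := by
  rw [Finset.coe_filter]
  exact hB.inter Set.ordConnected_Ioi

/-- The counts on the two sides of `b` are hypotheses, so that the lemma can be used inside the
strong induction that establishes them. -/
lemma outcomeCount_erase_of_forall {B : Finset α} {b : α} (hb : b ∈ B)
    (hl : ∀ l : List Bool, l.length = (B.filter (· < b)).card →
      outcomeCount l (B.filter (· < b)) = parkingNumber l.length)
    (hg : ∀ l : List Bool, l.length = (B.filter (b < ·)).card →
      outcomeCount l (B.filter (b < ·)) = parkingNumber l.length)
    (cs : List Bool) (hcs : cs.length + 1 = B.card) :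
    outcomeCount cs (B.erase b) = gapNumber cs.length (B.filter (· < b)).card := by
  have hcard := card_filter_lt_add_card_filter_gt hb
  rw [← filter_lt_union_filter_gt,
    outcomeCount_union (k := b) (fun x h => (Finset.mem_filter.mp h).2)
      (fun x h => (Finset.mem_filter.mp h).2)]
  have key : ∀ A : Finset α, (∀ l : List Bool, l.length = A.card →
      outcomeCount l A = parkingNumber l.length) → (fun l => outcomeCount l A)
        = fun l => if l.length = A.card then parkingNumber A.card else 0 := by
    intro A hA
    funext l
    split_ifs with h
    · rw [hA l h, h]
    · exact outcomeCount_eq_zero l A h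
  rw [key _ hl, key _ hg, shuffleSum_ite _ _ _ _ _ (by omega), gapNumber]
  have : cs.length = (B.filter (· < b)).card + (B.filter (b < ·)).card := by omega
  rw [this, Nat.add_sub_cancel_left]

/-- On an interval of spots, the number of preference lists which park all cars does not depend on
the coins. -/
theorem outcomeCount_of_ordConnected (cs : List Bool) {B : Finset α}
    (hB : (B : Set α).OrdConnected) (h : cs.length = B.card) :
    outcomeCount cs B = parkingNumber cs.length := by
  induction hm : cs.length using Nat.strong_induction_on generalizing cs B with
  | _ m ih =>
  rcases cs with _ | ⟨c, cs⟩
  · have : B = ∅ := Finset.card_eq_zero.mp h.symm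
    subst hm
    simp [outcomeCount, this, parkingNumber]
  simp only [List.length_cons] at h hm
  subst hm
  -- Each summand depends on `b` only through its rank in `B`.
  have hterm : ∀ b ∈ B, outcomeCount cs (B.erase b) * preferenceCount (B.erase b) c b
      = (fun i => gapNumber cs.length i * (if c = true then i + 1 else cs.length - i + 1))
        (B.filter (· < b)).card := by
    intro b hb
    have hcard := card_filter_lt_add_card_filter_gt hb
    rw [outcomeCount_erase_of_forall hb
      (fun l hl => ih l.length (by omega) l (ordConnected_filter_lt hB b) hl rfl)
      (fun l hl => ih l.length (by omega) l (ordConnected_filter_gt hB b) hl rfl) cs h,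
      preferenceCount_erase hB hb]
    dsimp only
    congr 2
    omega
  rw [outcomeCount, Finset.sum_congr rfl hterm,
    sum_card_filter_lt B fun i => gapNumber cs.length i * (if c = true then i + 1 else cs.length - i + 1),
    ← h]
  -- The two tosses give mirror-image sums with the same value, hence the independence of the coins.
  cases c
  · simpa using sum_gapNumber_mul_succ' cs.length
  · simpa using sum_gapNumber_mul_succ cs.length

theorem outcomeCount_erase {B : Finset α} (hB : (B : Set α).OrdConnected) {b : α} (hb : b ∈ B)
    (cs : List Bool) (hcs : cs.length + 1 = B.card) :
    outcomeCount cs (B.erase b) = gapNumber cs.length (B.filter (· < b)).card :=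
  outcomeCount_erase_of_forall hb
    (fun l hl => outcomeCount_of_ordConnected l (ordConnected_filter_lt hB b) hl)
    (fun l hl => outcomeCount_of_ordConnected l (ordConnected_filter_gt hB b) hl) cs hcs

end Outcome

/-! ### From the parking process to the counts -/

section Street

open Finset

/-- The case of a free preferred spot needs no separate clause: if `a ≠ b`, the condition on the
spots passed over would make `a` occupied. -/
lemma chooseSpot_eq_some {n : ℕ} {occ : Finset (Fin n)} {a b : Fin n} {heads : Bool} :
    chooseSpot occ a heads = some b ↔ b ∉ occ ∧
      if heads = true then a ≤ b ∧ ∀ y, a ≤ y → y < b → y ∈ occ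
        else b ≤ a ∧ ∀ y, b < y → y ≤ a → y ∈ occ := by
  unfold chooseSpot
  by_cases ha : a ∈ occ
  · rw [if_neg (not_not.mpr ha)]
    cases heads
    · simp only [Bool.false_eq_true, if_false]
      split_ifs with h
      · rw [Option.some_inj]
        constructor
        · rintro rfl
          have hm := mem_filter.mp (max'_mem _ h)
          refine ⟨hm.2.2, hm.2.1.le, fun y hy hya => ?_⟩
          by_contra hc
          have hya' : y < a := lt_of_le_of_ne hya fun e => hc (e ▸ ha)
          exact (le_max' _ y (mem_filter.mpr ⟨mem_univ _, hya', hc⟩)).not_gt hy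
        · rintro ⟨hb, hba, hy⟩
          have hba' : b < a := lt_of_le_of_ne hba fun e => hb (e ▸ ha)
          refine le_antisymm (max'_le _ _ _ fun y hy' => ?_)
            (le_max' _ b (mem_filter.mpr ⟨mem_univ _, hba', hb⟩))
          have hm := (mem_filter.mp hy').2
          by_contra hc
          exact hm.2 (hy y (not_le.mp hc) hm.1.le)
      · refine ⟨fun h' => by simp at h', ?_⟩
        rintro ⟨hb, hba, -⟩
        have hba' : b < a := lt_of_le_of_ne hba fun e => hb (e ▸ ha)
        exact absurd ⟨b, mem_filter.mpr ⟨mem_univ _, hba', hb⟩⟩ h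
    · simp only [if_true]
      split_ifs with h
      · rw [Option.some_inj]
        constructor
        · rintro rfl
          have hm := mem_filter.mp (min'_mem _ h)
          refine ⟨hm.2.2, hm.2.1.le, fun y hya hy => ?_⟩
          by_contra hc
          have hya' : a < y := lt_of_le_of_ne hya fun e => hc (e ▸ ha)
          exact (min'_le _ y (mem_filter.mpr ⟨mem_univ _, hya', hc⟩)).not_gt hy
        · rintro ⟨hb, hba, hy⟩
          have hba' : a < b := lt_of_le_of_ne hba fun e => hb (e ▸ ha)
          refine le_antisymm (min'_le _ b (mem_filter.mpr ⟨mem_univ _, hba', hb⟩))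
            (le_min' _ _ _ fun y hy' => ?_)
          have hm := (mem_filter.mp hy').2
          by_contra hc
          exact hm.2 (hy y hm.1.le (not_le.mp hc))
      · refine ⟨fun h' => by simp at h', ?_⟩
        rintro ⟨hb, hba, -⟩
        have hba' : a < b := lt_of_le_of_ne hba fun e => hb (e ▸ ha)
        exact absurd ⟨b, mem_filter.mpr ⟨mem_univ _, hba', hb⟩⟩ h
  · rw [if_pos ha, Option.some_inj]
    constructor
    · rintro rfl
      refine ⟨ha, ?_⟩
      split_ifs
      · exact ⟨le_rfl, fun y h h' => absurd (h.trans_lt h') (lt_irrefl _)⟩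
      · exact ⟨le_rfl, fun y h h' => absurd (h.trans_le h') (lt_irrefl _)⟩
    · rintro ⟨hb, h⟩
      split_ifs at h
      · by_contra hne
        exact ha (h.2 a le_rfl (lt_of_le_of_ne h.1 hne))
      · by_contra hne
        exact ha (h.2 a (lt_of_le_of_ne h.1 (Ne.symm hne)) le_rfl)

/-- The restriction to `insert b A` in `preferenceCount` loses nothing, since a car that has to move
prefers an occupied spot. -/
lemma card_chooseSpot_eq {n : ℕ} (A : Finset (Fin n)) (heads : Bool) {b : Fin n} (hb : b ∉ A) :
    (univ.filter fun x => chooseSpot A x heads = some b).card = preferenceCount A heads b := by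
  unfold preferenceCount
  congr 1
  ext x
  simp only [mem_filter, mem_univ, true_and, chooseSpot_eq_some, hb, not_false_eq_true,
    mem_insert]
  refine ⟨fun h => ⟨?_, h⟩, fun h => h.2⟩
  by_cases hx : x = b
  · exact Or.inl hx
  · right
    split_ifs at h
    · exact h.2 x le_rfl (lt_of_le_of_ne h.1 hx)
    · exact h.2 x (lt_of_le_of_ne h.1 (Ne.symm hx)) le_rfl

lemma occupied_init {m n : ℕ} (a : Fin (m + 1) → Fin n) (c : Fin (m + 1) → Bool) {i : ℕ}
    (hi : i ≤ m) : occupied a c i = occupied (Fin.init a) (Fin.init c) i := by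
  induction i with
  | zero => rfl
  | succ i ih =>
    simp only [occupied]
    rw [dif_pos (show i < m + 1 by omega), dif_pos (show i < m by omega), ih (by omega)]
    rfl

lemma occupied_last {m n : ℕ} (a : Fin (m + 1) → Fin n) (c : Fin (m + 1) → Bool) :
    occupied a c (m + 1) =
      match chooseSpot (occupied (Fin.init a) (Fin.init c) m) (a (Fin.last m)) (c (Fin.last m)) with
      | some s => insert s (occupied (Fin.init a) (Fin.init c) m)
      | none => occupied (Fin.init a) (Fin.init c) m := by
  rw [occupied, dif_pos (Nat.lt_succ_self m), occupied_init a c le_rfl]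
  rfl

lemma allPark_succ {m n : ℕ} (a : Fin (m + 1) → Fin n) (c : Fin (m + 1) → Bool) :
    AllPark a c ↔ AllPark (Fin.init a) (Fin.init c) ∧
      (chooseSpot (occupied (Fin.init a) (Fin.init c) m) (a (Fin.last m))
        (c (Fin.last m))).isSome = true := by
  unfold AllPark
  rw [Fin.forall_fin_succ']
  simp only [Fin.val_castSucc, Fin.val_last]
  rw [occupied_init a c le_rfl]
  refine and_congr_left' (forall_congr' fun i => ?_)
  rw [occupied_init a c i.2.le]
  rfl

lemma allPark_and_occupied_succ {m n : ℕ} (a : Fin (m + 1) → Fin n) (c : Fin (m + 1) → Bool)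
    (B : Finset (Fin n)) :
    AllPark a c ∧ occupied a c (m + 1) = B ↔ ∃ b ∈ B,
      (AllPark (Fin.init a) (Fin.init c) ∧ occupied (Fin.init a) (Fin.init c) m = B.erase b) ∧
        chooseSpot (B.erase b) (a (Fin.last m)) (c (Fin.last m)) = some b := by
  rw [allPark_succ, occupied_last]
  constructor
  · rintro ⟨⟨h1, h2⟩, h3⟩
    obtain ⟨b, hb⟩ := Option.isSome_iff_exists.mp h2
    rw [hb] at h3
    dsimp only at h3
    have hn := (chooseSpot_eq_some.mp hb).1
    have he : occupied (Fin.init a) (Fin.init c) m = B.erase b := by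
      rw [← h3, erase_insert hn]
    exact ⟨b, h3 ▸ mem_insert_self _ _, ⟨h1, he⟩, he ▸ hb⟩
  · rintro ⟨b, hb, ⟨h1, h2⟩, h3⟩
    rw [h2, h3]
    exact ⟨⟨h1, rfl⟩, insert_erase hb⟩

open Classical in
/-- The preference vectors which park all cars and occupy the set `B`. -/
noncomputable def outcomes {m n : ℕ} (c : Fin m → Bool) (B : Finset (Fin n)) :
    Finset (Fin m → Fin n) :=
  univ.filter fun a => AllPark a c ∧ occupied a c m = B

lemma mem_outcomes {m n : ℕ} {c : Fin m → Bool} {B : Finset (Fin n)} {a : Fin m → Fin n} :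
    a ∈ outcomes c B ↔ AllPark a c ∧ occupied a c m = B := by
  classical simp [outcomes]

/-- The tosses are reversed because the recursion of `outcomeCount` removes the last car first. -/
theorem card_outcomes {m n : ℕ} (c : Fin m → Bool) (B : Finset (Fin n)) :
    (outcomes c B).card = outcomeCount (List.ofFn c).reverse B := by
  induction m generalizing B with
  | zero =>
    rw [List.ofFn_zero, List.reverse_nil, outcomeCount]
    split_ifs with h
    · rw [card_eq_one]
      refine ⟨Fin.elim0, ?_⟩
      ext a
      rw [mem_outcomes, mem_singleton]
      exact ⟨fun _ => Subsingleton.elim _ _, fun _ => ⟨fun i => i.elim0, h.symm⟩⟩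
    · rw [card_eq_zero, eq_empty_iff_forall_notMem]
      exact fun a ha => h (mem_outcomes.mp ha).2.symm
  | succ m ih =>
    have hl : (List.ofFn c).reverse = c (Fin.last m) :: (List.ofFn (Fin.init c)).reverse := by
      rw [List.ofFn_succ', List.concat_eq_append, List.reverse_append]
      rfl
    have hB : (outcomes c B).map (Fin.snocEquiv fun _ => Fin n).symm.toEmbedding
        = B.biUnion fun b => (univ.filter fun x =>
          chooseSpot (B.erase b) x (c (Fin.last m)) = some b) ×ˢ
            outcomes (Fin.init c) (B.erase b) := by
      ext ⟨x, a⟩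
      rw [mem_map_equiv, Equiv.symm_symm, mem_outcomes, allPark_and_occupied_succ]
      simp only [Fin.snocEquiv, Equiv.coe_fn_mk, Fin.init_snoc, Fin.snoc_last, mem_biUnion,
        mem_product, mem_filter, mem_univ, true_and, mem_outcomes]
      exact exists_congr fun b => and_congr_right fun _ => and_comm
    rw [hl, outcomeCount, ← card_map, hB, card_biUnion]
    · refine sum_congr rfl fun b hb => ?_
      rw [card_product, ih, card_chooseSpot_eq _ _ (notMem_erase b B), mul_comm]
    -- The spot of the last car is determined by the set `B.erase b` occupied before it.
    · intro b hb b' hb' hne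
      refine disjoint_left.mpr fun p hp hp' => hne ?_
      have h1 := (mem_outcomes.mp (mem_product.mp hp).2).2
      have h2 := (mem_outcomes.mp (mem_product.mp hp').2).2
      exact erase_injOn B hb hb' (h1.symm.trans h2)

/-- A final set of any other size has outcome count zero, yet `a` itself would be counted. -/
lemma card_occupied {m n : ℕ} {a : Fin m → Fin n} {c : Fin m → Bool} (h : AllPark a c) :
    (occupied a c m).card = m := by
  by_contra hne
  have h0 := card_outcomes c (occupied a c m)
  rw [outcomeCount_eq_zero _ _ (by simpa using Ne.symm hne), card_eq_zero] at h0
  exact notMem_empty a (h0 ▸ mem_outcomes.mpr ⟨h, rfl⟩)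

lemma allPark_iff_mem_outcomes_univ {n : ℕ} {a : Fin n → Fin n} {c : Fin n → Bool} :
    AllPark a c ↔ a ∈ outcomes c univ := by
  rw [mem_outcomes]
  refine ⟨fun h => ⟨h, ?_⟩, fun h => h.1⟩
  rw [← card_eq_iff_eq_univ, card_occupied h, Fintype.card_fin]

/-- The number of preference vectors which park `n` cars on `n` spots. -/
theorem card_outcomes_univ {n : ℕ} (c : Fin n → Bool) :
    (outcomes c (univ : Finset (Fin n))).card = parkingNumber n := by
  rw [card_outcomes, outcomeCount_of_ordConnected _ (by simpa using Set.ordConnected_univ)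
    (by simp)]
  simp

/-- The number of ways for `m` cars to park on `m + 1` spots and leave the spot `k` free. -/
theorem card_outcomes_erase {m : ℕ} (c : Fin m → Bool) (k : Fin (m + 1)) :
    (outcomes c (univ.erase k)).card = gapNumber m k := by
  rw [card_outcomes, outcomeCount_erase (by simpa using Set.ordConnected_univ) (mem_univ k) _
    (by simp), List.length_reverse, List.length_ofFn]
  congr 1
  rw [Finset.filter_gt_eq_Iio, Fin.card_Iio]

lemma isSome_chooseSpot_erase {n : ℕ} (k j : Fin n) (heads : Bool) :
    (chooseSpot (univ.erase k) j heads).isSome = true ↔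
      if heads = true then j ≤ k else k ≤ j := by
  rw [Option.isSome_iff_exists]
  simp only [chooseSpot_eq_some, mem_erase, mem_univ, and_true, not_not]
  constructor
  · rintro ⟨b, rfl, h⟩
    split_ifs at h ⊢
    · exact h.1
    · exact h.1
  · intro h
    refine ⟨k, rfl, ?_⟩
    split_ifs at h ⊢
    · exact ⟨h, fun y _ h' => h'.ne⟩
    · exact ⟨h, fun y h' _ => h'.ne'⟩

open Classical in
/-- The number of preference vectors with last entry `j` which park all cars. -/
theorem card_allPark_last {m : ℕ} (c : Fin (m + 1) → Bool) (j : Fin (m + 1)) :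
    (univ.filter fun a : Fin (m + 1) → Fin (m + 1) => AllPark a c ∧ a (Fin.last m) = j).card
      = ∑ k : Fin (m + 1), if (if c (Fin.last m) = true then j ≤ k else k ≤ j)
          then gapNumber m k else 0 := by
  have hB : (univ.filter fun a : Fin (m + 1) → Fin (m + 1) => AllPark a c ∧ a (Fin.last m) = j).map
      (Fin.snocEquiv fun _ => Fin (m + 1)).symm.toEmbedding
        = {j} ×ˢ (univ.filter fun k => if c (Fin.last m) = true then j ≤ k else k ≤ j).biUnion
          fun k => outcomes (Fin.init c) (univ.erase k) := by
    ext ⟨x, a⟩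
    rw [mem_map_equiv, Equiv.symm_symm, mem_filter, allPark_succ]
    simp only [Fin.snocEquiv, Equiv.coe_fn_mk, Fin.init_snoc, Fin.snoc_last, mem_biUnion,
      mem_product, mem_filter, mem_univ, true_and, mem_outcomes, mem_singleton]
    constructor
    · rintro ⟨⟨h1, h2⟩, rfl⟩
      -- The first `m` cars leave a single free spot, and its position decides whether the last car
      -- parks.
      have hc : (occupied a (Fin.init c) m)ᶜ.card = 1 := by
        rw [card_compl, card_occupied h1, Fintype.card_fin, Nat.add_sub_cancel_left]
      obtain ⟨k, hk⟩ := card_eq_one.mp hc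
      have he : occupied a (Fin.init c) m = univ.erase k := by
        rw [← compl_compl (occupied a (Fin.init c) m), hk, compl_singleton]
      rw [he, isSome_chooseSpot_erase] at h2
      exact ⟨rfl, k, h2, h1, he⟩
    · rintro ⟨rfl, k, hk, h1, he⟩
      rw [he, isSome_chooseSpot_erase]
      exact ⟨⟨h1, hk⟩, rfl⟩
  rw [← card_map, hB, card_product, card_singleton, one_mul, card_biUnion, sum_filter]
  · simp only [card_outcomes_erase]
  · intro b _ b' _ hne
    refine disjoint_left.mpr fun p hp hp' => hne ?_
    exact erase_injOn univ (mem_univ b) (mem_univ b')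
      ((mem_outcomes.mp hp).2.symm.trans (mem_outcomes.mp hp').2)

/-- The number of ways for `m` cars to park on `m + 1` spots leaving free one of the first
`k` spots. -/
def gapSum (m k : ℕ) : ℕ := ∑ s ∈ range k, gapNumber m s

/-- By the symmetry `s ↔ m - s`, the terms from `k` on have the same sum as the first `m + 1 - k`
terms. -/
lemma gapSum_add_gapSum {m k : ℕ} (hk : k ≤ m + 1) :
    gapSum m k + gapSum m (m + 1 - k) = gapSum m (m + 1) := by
  unfold gapSum
  obtain ⟨d, hd⟩ := Nat.exists_eq_add_of_le hk
  rw [← sum_range_add_sum_Ico _ hk]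
  congr 1
  rw [sum_Ico_eq_sum_range, ← sum_range_reflect]
  refine sum_congr rfl fun s hs => ?_
  have := mem_range.mp hs
  rw [← gapNumber_symm (show k + s ≤ m by omega)]
  congr 1
  omega

/-- A car with a given toss which prefers the spot `j` parks for `gapSum` many outcomes of the
previous cars. -/
lemma sum_ite_gapNumber {m : ℕ} (heads : Bool) (j : Fin (m + 1)) :
    (∑ k : Fin (m + 1), if (if heads = true then j ≤ k else k ≤ j) then gapNumber m k else 0)
      = if heads = true then gapSum m (m + 1 - j) else gapSum m (j + 1) := by
  cases heads
  · simp only [Bool.false_eq_true, if_false, Fin.le_def]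
    rw [Fin.sum_univ_eq_sum_range (fun k => if k ≤ (j : ℕ) then gapNumber m k else 0), gapSum,
      ← sum_filter]
    refine sum_congr ?_ fun _ _ => rfl
    ext x
    simp only [mem_filter, mem_range]
    omega
  · simp only [if_true, Fin.le_def]
    rw [Fin.sum_univ_eq_sum_range (fun k => if (j : ℕ) ≤ k then gapNumber m k else 0)]
    have h := gapSum_add_gapSum (m := m) (k := j) (by omega)
    have h2 := sum_range_add_sum_Ico (fun k => gapNumber m k) (show (j : ℕ) ≤ m + 1 by omega)
    have h3 : (∑ k ∈ range (m + 1), if (j : ℕ) ≤ k then gapNumber m k else 0)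
        = ∑ k ∈ Ico (j : ℕ) (m + 1), gapNumber m k := by
      rw [← sum_filter]
      refine sum_congr ?_ fun _ _ => rfl
      ext x
      simp only [mem_filter, mem_range, mem_Ico]
      omega
    rw [h3]
    unfold gapSum at h ⊢
    omega

end Street

/-! ### From counts to conditional probabilities -/

section Measure

open MeasureTheory ProbabilityTheory

open Classical in
/-- The probability of an event for which the number of favourable preference vectors depends only
on the toss of one car. -/
lemma parkingMeasure_apply {n : ℕ} (p : I) (E : Set ((Fin n → Fin n) × (Fin n → Bool))) (i : Fin n)
    (h : Bool → ℕ)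
    (hE : ∀ c, (Finset.univ.filter fun a : Fin n → Fin n => (a, c) ∈ E).card = h (c i)) :
    (parkingMeasure n p).real E = ((p : ℝ) * h true + (1 - (p : ℝ)) * h false) / (n : ℝ) ^ n := by
  have : Nonempty (Fin n) := ⟨i⟩
  have hm : MeasurableSet E := E.toFinite.measurableSet
  -- Integrating out the preferences first leaves a function of the toss `c i`, so only the marginal
  -- law of one coin remains.
  have h1 : parkingMeasure n p E
      = ∫⁻ b, (h b : ENNReal) / ((n : ENNReal) ^ n) ∂(bernoulliMeasure true false p) := by
    rw [parkingMeasure, Measure.prod_apply_symm hm,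
      ← (measurePreserving_eval (fun _ : Fin n => bernoulliMeasure true false p) i).lintegral_comp
        (measurable_of_countable _)]
    refine lintegral_congr fun c => ?_
    have hs : (fun a => (a, c)) ⁻¹' E
        = ((Finset.univ.filter fun a : Fin n → Fin n => (a, c) ∈ E : Finset _) : Set _) := by
      ext a; simp
    rw [uniformOn_univ, hs, Measure.count_apply_finset, hE]
    simp
  rw [measureReal_def, h1, bernoulliMeasure_def, lintegral_add_measure, lintegral_smul_measure,
    lintegral_smul_measure, lintegral_dirac, lintegral_dirac]
  have hn : (n : ENNReal) ^ n ≠ 0 := pow_ne_zero _ (by simpa using i.pos.ne')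
  have hf : ∀ b, (h b : ENNReal) / (n : ENNReal) ^ n ≠ ⊤ := fun b =>
    (ENNReal.div_lt_top (ENNReal.natCast_ne_top _) hn).ne
  rw [ENNReal.toReal_add]
  · simp only [ENNReal.smul_def, smul_eq_mul, ENNReal.toReal_mul, ENNReal.toReal_div,
      ENNReal.toReal_pow, ENNReal.toReal_natCast, ENNReal.coe_toReal]
    simp
    ring
  · exact ENNReal.mul_ne_top ENNReal.coe_ne_top (hf _)
  · exact ENNReal.mul_ne_top ENNReal.coe_ne_top (hf _)

lemma parkingMeasure_parkEvent {n : ℕ} (hn : 1 ≤ n) (p : I) :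
    (parkingMeasure n p).real (parkEvent n) = (parkingNumber n : ℝ) / (n : ℝ) ^ n := by
  rw [parkingMeasure_apply p _ ⟨0, hn⟩ fun _ => parkingNumber n]
  · ring
  · intro c
    rw [← card_outcomes_univ c]
    congr 1
    ext a
    simp [parkEvent, allPark_iff_mem_outcomes_univ]

/-- The law of the last preference in terms of partial sums. -/
theorem lastPrefLaw_eq (m : ℕ) (p : I) {i : ℕ} (hi : i ≤ m) :
    lastPrefLaw (m + 1) (Nat.le_add_left 1 m) p (i + 1)
      = ((p : ℝ) * gapSum m (m + 1 - i) + (1 - (p : ℝ)) * gapSum m (i + 1))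
        / ((m : ℝ) + 2) ^ m := by
  classical
  have hm : MeasurableSet (parkEvent (m + 1)) := (parkEvent (m + 1)).toFinite.measurableSet
  have h2 : (parkingMeasure (m + 1) p).real (parkEvent (m + 1) ∩
      lastPrefEvent (m + 1) (Nat.le_add_left 1 m) (i + 1))
      = ((p : ℝ) * gapSum m (m + 1 - i) + (1 - (p : ℝ)) * gapSum m (i + 1))
        / ((m + 1 : ℕ) : ℝ) ^ (m + 1) := by
    rw [parkingMeasure_apply p _ (Fin.last m)
      fun b => if b = true then gapSum m (m + 1 - i) else gapSum m (i + 1)]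
    · simp
    · intro c
      have h := card_allPark_last c ⟨i, Nat.lt_succ_of_le hi⟩
      rw [sum_ite_gapNumber] at h
      rw [← h]
      congr 1
      ext a
      simp only [Finset.mem_filter, Finset.mem_univ, true_and, parkEvent, lastPrefEvent,
        Set.mem_inter_iff, Set.mem_ofPred_eq, Fin.ext_iff, Nat.add_right_cancel_iff]
      rfl
  have hP : ((parkingNumber (m + 1) : ℕ) : ℝ) = ((m : ℝ) + 2) ^ m := by
    rw [parkingNumber, Nat.add_sub_cancel]; push_cast; ring
  rw [lastPrefLaw, measureReal_def, cond_apply hm, ENNReal.toReal_mul, ENNReal.toReal_inv,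
    ← measureReal_def, ← measureReal_def, h2, parkingMeasure_parkEvent (Nat.le_add_left 1 m), hP]
  have : ((m + 1 : ℕ) : ℝ) ^ (m + 1) ≠ 0 := by positivity
  have : ((m : ℝ) + 2) ^ m ≠ 0 := by positivity
  field_simp

end Measure

/-! ### The closed formula and the dependence on `p` -/

lemma gapNumber_cast {m s : ℕ} (hs : s ≤ m) :
    (m.choose s : ℝ) * (((m + 1 : ℕ) : ℝ) - (s : ℝ)) ^ (((m + 1 : ℕ) : ℤ) - (s : ℤ) - 2)
      * ((s : ℝ) + 1) ^ ((s : ℤ) - 1) = gapNumber m s := by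
  have key : ∀ k : ℕ, ((k : ℝ) + 1) ^ ((k : ℤ) - 1) = parkingNumber k := by
    intro k
    -- At `k = 0` the integer exponent is `-1` and the natural one is `0`, but the base is `1`.
    rcases k with _ | k
    · simp [parkingNumber]
    · rw [parkingNumber, Nat.add_sub_cancel, Nat.cast_pow, ← zpow_natCast]
      push_cast
      congr 1
      ring
  obtain ⟨d, rfl⟩ := Nat.exists_eq_add_of_le hs
  rw [key s, gapNumber, Nat.add_sub_cancel_left]
  have e1 : ((s + d + 1 : ℕ) : ℝ) - (s : ℝ) = (d : ℝ) + 1 := by push_cast; ring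
  have e2 : ((s + d + 1 : ℕ) : ℤ) - (s : ℤ) - 2 = (d : ℤ) - 1 := by push_cast; ring
  rw [e1, e2, key d]
  push_cast
  ring

/-- The index set consists of the last `i` values of `s`, which symmetry exchanges with the first
`i`. -/
lemma sum_Icc_gapNumber {m i : ℕ} (hi : i ≤ m) :
    ∑ s ∈ Finset.Icc (m + 1 - (i + 1) + 1) (m + 1 - 1), gapNumber m s = gapSum m i := by
  have h := gapSum_add_gapSum (m := m) (k := i) (by omega)
  have h2 := Finset.sum_range_add_sum_Ico (fun k => gapNumber m k)
    (show m + 1 - i ≤ m + 1 by omega)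
  have h3 : Finset.Icc (m + 1 - (i + 1) + 1) (m + 1 - 1) = Finset.Ico (m + 1 - i) (m + 1) := by
    ext x
    simp only [Finset.mem_Icc, Finset.mem_Ico]
    omega
  rw [h3]
  unfold gapSum at h ⊢
  omega

end CoinParking

theorem theorem3 (n : ℕ) (hn : 1 ≤ n) :
    -- conditioning on the event that all cars park is meaningful
    (∀ p : unitInterval, CoinParking.parkingMeasure n p (CoinParking.parkEvent n) ≠ 0) ∧
    -- the conditional law of the preference of the last car
    (∀ (p : unitInterval) (j : ℕ), 1 ≤ j → j ≤ n →
      CoinParking.lastPrefLaw n hn p j =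
        2 / ((n : ℝ) + 1) - 1 / ((n : ℝ) + 1) ^ (n - 1) *
          ((p : ℝ) * ∑ s ∈ Finset.Icc (n - j + 1) (n - 1),
              ((n - 1).choose s : ℝ) * ((n : ℝ) - (s : ℝ)) ^ ((n : ℤ) - (s : ℤ) - 2)
                * ((s : ℝ) + 1) ^ ((s : ℤ) - 1)
            + (1 - (p : ℝ)) * ∑ s ∈ Finset.range (n - j),
              ((n - 1).choose s : ℝ) * ((n : ℝ) - (s : ℝ)) ^ ((n : ℤ) - (s : ℤ) - 2)
                * ((s : ℝ) + 1) ^ ((s : ℤ) - 1))) ∧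
    -- it is a convex combination of the cases `p = 1` and `p = 0`
    (∀ (p : unitInterval) (j : ℕ), 1 ≤ j → j ≤ n →
      CoinParking.lastPrefLaw n hn p j =
        (p : ℝ) * CoinParking.lastPrefLaw n hn 1 j
          + (1 - (p : ℝ)) * CoinParking.lastPrefLaw n hn 0 j) ∧
    -- it depends on `p` as soon as there are two cars
    (2 ≤ n → ∀ p q : unitInterval, p ≠ q →
      ∃ j : ℕ, 1 ≤ j ∧ j ≤ n ∧
        CoinParking.lastPrefLaw n hn p j ≠ CoinParking.lastPrefLaw n hn q j) := by
  open CoinParking in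
  obtain ⟨m, rfl⟩ := Nat.exists_eq_add_of_le' hn
  refine ⟨fun p h0 => ?_, fun p j hj hjn => ?_, fun p j hj hjn => ?_, fun hm p q hpq => ?_⟩
  · have h := parkingMeasure_parkEvent hn p
    rw [MeasureTheory.measureReal_def, h0, ENNReal.toReal_zero] at h
    have : (0 : ℝ) < (parkingNumber (m + 1) : ℝ) / ((m + 1 : ℕ) : ℝ) ^ (m + 1) := by
      unfold parkingNumber; positivity
    exact this.ne h
  · obtain ⟨i, rfl⟩ := Nat.exists_eq_add_of_le' hj
    have hi : i ≤ m := by omega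
    have e1 : ∑ s ∈ Finset.Icc (m + 1 - (i + 1) + 1) (m + 1 - 1),
        ((m + 1 - 1).choose s : ℝ) *
          (((m + 1 : ℕ) : ℝ) - (s : ℝ)) ^ (((m + 1 : ℕ) : ℤ) - (s : ℤ) - 2)
            * ((s : ℝ) + 1) ^ ((s : ℤ) - 1) = gapSum m i := by
      rw [← sum_Icc_gapNumber hi, Nat.cast_sum]
      refine Finset.sum_congr rfl fun s hs => gapNumber_cast ?_
      have := (Finset.mem_Icc.mp hs).2
      omega
    have e2 : ∑ s ∈ Finset.range (m + 1 - (i + 1)),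
        ((m + 1 - 1).choose s : ℝ) *
          (((m + 1 : ℕ) : ℝ) - (s : ℝ)) ^ (((m + 1 : ℕ) : ℤ) - (s : ℤ) - 2)
            * ((s : ℝ) + 1) ^ ((s : ℤ) - 1) = gapSum m (m + 1 - (i + 1)) := by
      rw [gapSum, Nat.cast_sum]
      refine Finset.sum_congr rfl fun s hs => gapNumber_cast ?_
      have := Finset.mem_range.mp hs
      omega
    have h1 : (gapSum m i : ℝ) + gapSum m (m + 1 - i) = gapSum m (m + 1) := by
      exact_mod_cast gapSum_add_gapSum (by omega)
    have h2 : (gapSum m (i + 1) : ℝ) + gapSum m (m + 1 - (i + 1)) = gapSum m (m + 1) := by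
      exact_mod_cast gapSum_add_gapSum (by omega)
    have h3 : (gapSum m (m + 1) : ℝ) * (m + 2) = 2 * ((m : ℝ) + 2) ^ m := by
      have h := sum_gapNumber m
      rw [← Finset.sum_mul, parkingNumber, Nat.add_sub_cancel] at h
      exact_mod_cast h
    rw [e1, e2, lastPrefLaw_eq m p hi, Nat.add_sub_cancel]
    have e3 : ((m + 1 : ℕ) : ℝ) + 1 = (m : ℝ) + 2 := by push_cast; ring
    have hpos : (0 : ℝ) < (m : ℝ) + 2 := by positivity
    have hpow : ((m : ℝ) + 2) ^ m ≠ 0 := (pow_pos hpos m).ne'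
    -- The leading term of the formula is the normalised total; both partial sums are then
    -- complements in it.
    have e4 : 2 / ((m : ℝ) + 2) = gapSum m (m + 1) / ((m : ℝ) + 2) ^ m := by
      rw [div_eq_div_iff hpos.ne' hpow, h3]
    rw [e3, e4, ← h2, eq_sub_of_add_eq' h1, ← h2]
    field_simp
    ring
  · obtain ⟨i, rfl⟩ := Nat.exists_eq_add_of_le' hj
    have hi : i ≤ m := by omega
    rw [lastPrefLaw_eq m p hi, lastPrefLaw_eq m 1 hi, lastPrefLaw_eq m 0 hi]
    simp
    ring
  -- For `j = 1` a forward car parks whichever spot is left, a backward car only if spot `1` is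
  -- left. The two counts differ because spot `m + 1`, distinct from spot `1`, can also be the one
  -- left.
  · refine ⟨0 + 1, le_rfl, hn, fun h => hpq ?_⟩
    rw [lastPrefLaw_eq m p (Nat.zero_le m), lastPrefLaw_eq m q (Nat.zero_le m),
      div_left_inj' (by positivity)] at h
    have hlt : gapSum m (0 + 1) < gapSum m (m + 1 - 0) := by
      have hg : 0 < gapNumber m m := by
        rw [gapNumber, Nat.choose_self]
        unfold parkingNumber
        positivity
      have hle : gapSum m (0 + 1) ≤ gapSum m m := by
        unfold gapSum
        exact Finset.sum_le_sum_of_subset (Finset.range_mono (by omega))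
      have hs : gapSum m (m + 1 - 0) = gapSum m m + gapNumber m m := Finset.sum_range_succ _ _
      omega
    have hlt' : (gapSum m (0 + 1) : ℝ) < gapSum m (m + 1 - 0) := by exact_mod_cast hlt
    have h0 : ((p : ℝ) - q) * ((gapSum m (m + 1 - 0) : ℝ) - gapSum m (0 + 1)) = 0 := by
      linear_combination h
    rcases mul_eq_zero.mp h0 with h' | h'
    · exact Subtype.ext (sub_eq_zero.mp h')
    · exact absurd h' (sub_pos.mpr hlt').ne'
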